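/- Let $p$ be an odd prime and let $(\frac{\cdot}{p})$ be the Legendre symbol. For $\delta\in\{0,1\}$ and $w$ an element of a commutative ring with identity (for instance a number or an indeterminate), define $$D_p^{(\delta)}(w)=\det\left[\left(\frac{j^2-k^2}{p}\right)+\left(\frac{jk}{p}\right)w\right]_{\delta\le j,k\le (p-1)/2}-\det\left[\left(\frac{j^2-k^2}{p}\right)\right]_{\delta\le j,k\le (p-1)/2}.$$ (i) If $p\equiv 1\pmod 4$, then there is a positive odd integer $c_p$, depending only on $p$, such that for all $w$ $$D_p^{(0)}(w)=\frac{p-1}{2}\,D_p^{(1)}(w)=-w\left(\frac{p-1}{2}\,c_p\right)^2.$$ (ii) If $p\equiv 3\pmod 4$, then $D_p^{(0)}(w)=0$ for all $w$, and there is a positive odd integer $c_p$, depending only on $p$, such that for all $w$ $$D_p^{(1)}(w)=w\left(c_p\sum_{k=1}^{(p-1)/2}\left(\frac{k}{p}\right)\right)^2.$$ -/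

import Mathlib

universe u

/-- The determinant `|((j² - k²)/p) + (jk/p) w|` with rows `j` and columns `k` running over the
integers from `δ` to `(p - 1) / 2`, over a commutative ring `R`; here `(·/p)` is the Legendre
symbol. -/
def legendreDet (p : ℕ) [Fact p.Prime] (δ : ℕ) {R : Type*} [CommRing R] (w : R) : R :=
  Matrix.det (Matrix.of fun j k : ↥(Finset.Icc δ ((p - 1) / 2)) =>
    ((legendreSym p ((j : ℤ) ^ 2 - (k : ℤ) ^ 2) : ℤ) : R) +
      ((legendreSym p ((j : ℤ) * (k : ℤ)) : ℤ) : R) * w)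

/-- The determinant `|((j² - k²)/p)|` with rows `j` and columns `k` running over the integers
from `δ` to `(p - 1) / 2`, over a commutative ring `R`. -/
def legendreDetZero (p : ℕ) [Fact p.Prime] (δ : ℕ) (R : Type*) [CommRing R] : R :=
  Matrix.det (Matrix.of fun j k : ↥(Finset.Icc δ ((p - 1) / 2)) =>
    ((legendreSym p ((j : ℤ) ^ 2 - (k : ℤ) ^ 2) : ℤ) : R))

/-- The difference `D_p^{(δ)}(w)` of the two determinants above. -/
def legendreD (p : ℕ) [Fact p.Prime] (δ : ℕ) {R : Type*} [CommRing R] (w : R) : R :=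
  legendreDet p δ w - legendreDetZero p δ R

/-!
Write `A` for the matrix `((j² - k²)/p)`, `v` for the vector `(j/p)` and `n` for `(p - 1) / 2`.
Since `(jk/p) = v_j v_k`, the matrix in question is a rank-one change of `A`, and
`Matrix.det_add_vecMulVec` gives `D_p^{(δ)}(w) = w · vᵀ adj(A) v` (`legendreD_eq`). What remains is
to evaluate an integer. Besides the row sums of `A`, which come from a Jacobi sum, two facts about
integer matrices do the work: a skew-symmetric determinant is a square, and a matrix of even size
with zero diagonal and odd off-diagonal entries has odd determinant.

If `p ≡ 3 (mod 4)`, then `A` is skew-symmetric. For `δ = 0` the size is even, so `adj(A)` is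
skew-symmetric and the quadratic form vanishes. For `δ = 1` the rows sum to zero, so `adj(A)` is a
multiple `γ` of the all-ones matrix, and `γ n²` is the determinant for `δ = 0`, an odd square
(`Matrix.exists_adjugate_eq_sq_of_transpose_eq_neg`).

If `p ≡ 1 (mod 4)`, then `A` is symmetric with row sums `-1`, and `v` sums to zero, so adding
columns reduces `δ = 0` to `δ = 1` (`legendreDet_zero_eq`). For `δ = 1`, `A` commutes with the
permutation operator `T` of multiplication by a primitive root on `(ℤ/p)ˣ / {±1}`, and `1` and `v`
are eigenvectors of `A` that span the kernel of `T - T⁻¹`. On their orthogonal complement the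
symmetric `A` and the invertible skew-symmetric `T - T⁻¹` commute, so their product is
skew-symmetric, and the determinant of `A` there is a quotient of two squares. Extending
`T - T⁻¹` by a rotation of the span of `1` and `v`, and adjusting the eigenvalue of `v`, turns this
into a statement about full determinants
(`Matrix.exists_dotProduct_adjugate_eq_neg_sq`).
-/

open Matrix

/-! ### Determinants of rank-one updates and of skew-symmetric matrices -/

/-- The rank-one update formula for determinants, without any invertibility assumption. -/
theorem Matrix.det_add_vecMulVec {ι R : Type*} [Fintype ι] [DecidableEq ι] [CommRing R]
    (A : Matrix ι ι R) (u v : ι → R) :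
    (A + vecMulVec u v).det = A.det + v ⬝ᵥ (A.adjugate *ᵥ u) := by
  -- Add the multiples `u i • v` to the rows of `A` one row at a time.
  have key : ∀ s : Finset ι,
      (Matrix.of fun i j => A i j + if i ∈ s then u i * v j else 0).det =
        A.det + ∑ i ∈ s, u i * (A.updateRow i v).det := by
    intro s
    induction s using Finset.induction_on with
    | empty => simp only [Finset.notMem_empty, if_false, add_zero, Finset.sum_empty]; rfl
    | insert a s ha ih =>
      rw [Finset.sum_insert ha, ← add_assoc, add_right_comm, ← ih]
      set B : Matrix ι ι R := Matrix.of fun i j => A i j + if i ∈ s then u i * v j else 0 with hB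
      have h1 : (Matrix.of fun i j => A i j + if i ∈ insert a s then u i * v j else 0) =
          B.updateRow a (B a + u a • v) := by
        ext i j
        by_cases hi : i = a
        · subst hi; simp [hB, ha]
        · simp [hB, hi, Matrix.updateRow_ne]
      have h2 : (B.updateRow a v).det = (A.updateRow a v).det := by
        refine Matrix.det_eq_of_forall_row_eq_smul_add_const
          (fun i => if i ∈ s then u i else 0) a (by simp [ha]) ?_
        intro i j
        by_cases hi : i = a
        · subst hi; simp [ha]
        · by_cases his : i ∈ s <;> simp [hB, hi, his]
      rw [h1, Matrix.det_updateRow_add, Matrix.updateRow_eq_self, Matrix.det_updateRow_smul, h2]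
  have h := key Finset.univ
  have e : (Matrix.of fun i j => A i j + if i ∈ Finset.univ then u i * v j else 0) =
      A + vecMulVec u v := by
    ext i j; simp [vecMulVec_apply]
  rw [e] at h
  rw [h, Matrix.dotProduct_mulVec, ← Matrix.mulVec_transpose, Matrix.adjugate_transpose,
    ← Matrix.cramer_eq_adjugate_mulVec, dotProduct_comm]
  simp [dotProduct, Matrix.cramer_transpose_apply]

/-- A skew-symmetric determinant over a field of characteristic other than two is a square: split
off a nonzero `2 × 2` principal block and pass to its Schur complement, which is again
skew-symmetric. -/
theorem Matrix.isSquare_det_of_transpose_eq_neg {K : Type*} [Field K] (h2 : (2 : K) ≠ 0)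
    {ι : Type*} [Fintype ι] [DecidableEq ι] (M : Matrix ι ι K) (hM : Mᵀ = -M) :
    IsSquare M.det := by
  obtain ⟨n, hn⟩ : ∃ n, Fintype.card ι = n := ⟨_, rfl⟩
  induction n using Nat.strong_induction_on generalizing ι with
  | _ n ih =>
  by_cases h0 : M = 0
  · subst h0
    cases isEmpty_or_nonempty ι
    · exact ⟨1, by simp⟩
    · exact ⟨0, by simp [Matrix.det_zero]⟩
  have hsk : ∀ i j, M j i = -M i j := fun i j => congrFun (congrFun hM i) j
  have hd : ∀ i, M i i = 0 := fun i => by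
    have := hsk i i
    have h3 : 2 * M i i = 0 := by linear_combination this
    exact (mul_eq_zero.mp h3).resolve_left h2
  obtain ⟨i, j, hij⟩ : ∃ i j, M i j ≠ 0 := by
    by_contra! h
    exact h0 (Matrix.ext h)
  have hne : i ≠ j := fun h => hij (h ▸ hd i)
  let f : Fin 2 ⊕ {k // k ≠ i ∧ k ≠ j} → ι := Sum.elim ![i, j] Subtype.val
  have hf : Function.Bijective f := by
    constructor
    · refine Function.Injective.sumElim ?_ Subtype.val_injective ?_
      · intro a b h
        fin_cases a <;> fin_cases b
        · rfl
        · exact absurd h hne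
        · exact absurd h hne.symm
        · rfl
      · rintro a ⟨b, hbi, hbj⟩ h
        fin_cases a
        · exact hbi h.symm
        · exact hbj h.symm
    · intro k
      by_cases hi : k = i
      · exact ⟨Sum.inl 0, by simp [f, hi]⟩
      by_cases hj : k = j
      · exact ⟨Sum.inl 1, by simp [f, hj]⟩
      exact ⟨Sum.inr ⟨k, hi, hj⟩, rfl⟩
  let e := Equiv.ofBijective f hf
  let N := M.submatrix e e
  have hN : Nᵀ = -N := by ext a b; exact hsk _ _
  have hdet : N.det = M.det := Matrix.det_submatrix_equiv_self e M
  have hb11 : N.toBlocks₁₁.det = M i j * M i j := by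
    rw [Matrix.det_fin_two]
    change M i i * M j j - M i j * M j i = _
    rw [hd, hd, hsk i j]; ring
  have hcard : Fintype.card {k // k ≠ i ∧ k ≠ j} < n := by
    have := Fintype.card_congr e
    rw [Fintype.card_sum, Fintype.card_fin] at this
    omega
  have hu : IsUnit N.toBlocks₁₁.det := by rw [hb11]; exact (mul_ne_zero hij hij).isUnit
  let _ := Matrix.invertibleOfIsUnitDet _ hu
  have h11 : (N.toBlocks₁₁)ᵀ = -N.toBlocks₁₁ := by ext a b; exact hsk _ _
  have h12 : (N.toBlocks₁₂)ᵀ = -N.toBlocks₂₁ := by ext a b; exact hsk _ _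
  have h21 : (N.toBlocks₂₁)ᵀ = -N.toBlocks₁₂ := by ext a b; exact hsk _ _
  have h22 : (N.toBlocks₂₂)ᵀ = -N.toBlocks₂₂ := by ext a b; exact hsk _ _
  have hinv : (N.toBlocks₁₁⁻¹)ᵀ = -N.toBlocks₁₁⁻¹ := by
    rw [Matrix.transpose_nonsing_inv, h11]
    exact Matrix.inv_eq_left_inv (by
      rw [neg_mul_neg, Matrix.nonsing_inv_mul _ hu])
  obtain ⟨r, hr⟩ := ih _ hcard
    (N.toBlocks₂₂ - N.toBlocks₂₁ * ⅟(N.toBlocks₁₁) * N.toBlocks₁₂) (by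
      rw [Matrix.invOf_eq_nonsing_inv, Matrix.transpose_sub, Matrix.transpose_mul,
        Matrix.transpose_mul, hinv, h12, h21, h22]
      simp only [Matrix.mul_assoc, neg_neg, Matrix.neg_mul, Matrix.mul_neg]
      abel) rfl
  refine ⟨M i j * r, ?_⟩
  rw [← hdet, ← Matrix.fromBlocks_toBlocks N, Matrix.det_fromBlocks₁₁, hb11, hr]
  ring

theorem Matrix.isSquare_det_int_of_transpose_eq_neg {ι : Type*} [Fintype ι] [DecidableEq ι]
    (M : Matrix ι ι ℤ) (hM : Mᵀ = -M) : IsSquare M.det := by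
  rw [← Rat.isSquare_intCast_iff]
  have h := Matrix.isSquare_det_of_transpose_eq_neg (K := ℚ) two_ne_zero
    (M.map (Int.castRingHom ℚ)) (by
      ext i j
      have := congrFun (congrFun hM i) j
      simp only [transpose_apply, neg_apply] at this
      simp [this])
  have e := (Int.castRingHom ℚ).map_det M
  rw [RingHom.mapMatrix_apply] at e
  rw [← e] at h
  exact h

/-- Modulo two such a matrix is `J - 1` with `J` the all-ones matrix, an involution when the size
is even. -/
theorem Matrix.odd_det_of_odd_off_diag {ι : Type*} [Fintype ι] [DecidableEq ι]
    (hι : Even (Fintype.card ι)) (M : Matrix ι ι ℤ) (hd : ∀ i, M i i = 0)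
    (ho : ∀ i j, i ≠ j → Odd (M i j)) : Odd M.det := by
  let N : Matrix ι ι (ZMod 2) := Matrix.of fun i j => 1 - if i = j then 1 else 0
  have hN : (Int.castRingHom (ZMod 2)).mapMatrix M = N := by
    ext i j
    by_cases h : i = j
    · subst h; simp [N, hd]
    · simpa [N, h] using ZMod.intCast_eq_one_iff_odd.mpr (ho i j h)
  have hc : ((Fintype.card ι : ℕ) : ZMod 2) = 0 := (ZMod.natCast_eq_zero_iff_even).mpr hι
  have hsq : N * N = 1 := by
    ext i j
    simp only [N, Matrix.mul_apply, Matrix.of_apply, mul_sub, mul_one,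
      Finset.sum_sub_distrib, Finset.sum_const, Finset.card_univ, nsmul_eq_mul, hc, mul_ite,
      mul_zero, Finset.sum_ite_eq, Finset.sum_ite_eq', Finset.mem_univ, if_true, Matrix.one_apply]
    have : (2 : ZMod 2) = 0 := by decide
    split_ifs <;> linear_combination (-1 : ZMod 2) * this
  have hdet : N.det * N.det = 1 := by rw [← Matrix.det_mul, hsq, Matrix.det_one]
  rw [← ZMod.intCast_eq_one_iff_odd]
  have e : ((M.det : ℤ) : ZMod 2) = N.det := by
    rw [← hN]; exact (Int.castRingHom (ZMod 2)).map_det M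
  rw [e]
  generalize N.det = x at hdet
  revert x; decide

theorem Matrix.dotProduct_adjugate_mulVec_eq_zero {ι : Type*} [Fintype ι] [DecidableEq ι]
    (hι : Even (Fintype.card ι)) (M : Matrix ι ι ℤ) (hM : Mᵀ = -M) (x : ι → ℤ) :
    x ⬝ᵥ (M.adjugate *ᵥ x) = 0 := by
  cases isEmpty_or_nonempty ι
  · simp [dotProduct]
  have h1 : M.adjugateᵀ = -M.adjugate := by
    have h3 : (-1 : ℤ) ^ (Fintype.card ι - 1) = -1 :=
      (Nat.Even.sub_odd Fintype.card_pos hι odd_one).neg_one_pow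
    rw [Matrix.adjugate_transpose, hM, ← neg_one_smul ℤ M, Matrix.adjugate_smul, h3,
      neg_one_smul]
  have h2 : x ⬝ᵥ (M.adjugate *ᵥ x) = -(x ⬝ᵥ (M.adjugate *ᵥ x)) := by
    conv_lhs => rw [Matrix.dotProduct_mulVec, ← Matrix.mulVec_transpose, h1, dotProduct_comm,
      Matrix.neg_mulVec, dotProduct_neg]
  omega

/-- A skew-symmetric matrix of odd size with zero row sums and odd off-diagonal entries has
adjugate `c² J`, with `J` the all-ones matrix. The kernel is spanned by the all-ones vector, so the
adjugate is a multiple of `J`; bordering with ones gives a skew-symmetric matrix of even size,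
whose determinant is at once a square, odd, and that multiple times the square of the size. -/
theorem Matrix.exists_adjugate_eq_sq_of_transpose_eq_neg {ι : Type*} [Fintype ι] [DecidableEq ι]
    (hι : Odd (Fintype.card ι)) (A : Matrix ι ι ℤ) (hA : Aᵀ = -A)
    (ho : ∀ i j, i ≠ j → Odd (A i j)) (h1 : ∀ i, ∑ j, A i j = 0) :
    ∃ c : ℤ, 0 < c ∧ Odd c ∧ ∀ i j, A.adjugate i j = c ^ 2 := by
  have hsk : ∀ i j, A j i = -A i j := fun i j => congrFun (congrFun hA i) j
  have hd : ∀ i, A i i = 0 := fun i => by have := hsk i i; omega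
  have hpos : 0 < Fintype.card ι := hι.pos
  have : Nonempty ι := Fintype.card_pos_iff.mp hpos
  set n : ℤ := (Fintype.card ι : ℤ) with hn
  have hn0 : n ≠ 0 := by omega
  let B : Matrix (Unit ⊕ ι) (Unit ⊕ ι) ℤ :=
    fromBlocks 0 (Matrix.of fun _ _ => -1) (Matrix.of fun _ _ => 1) A
  have hB : Bᵀ = -B := by
    ext (i | i) (j | j)
    · simp [B]
    · simp [B]
    · simp [B]
    · exact hsk i j
  have hcardB : Even (Fintype.card (Unit ⊕ ι)) := by
    rw [Fintype.card_sum, Fintype.card_unit, add_comm]; exact hι.add_odd odd_one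
  have hBodd : Odd B.det := by
    refine odd_det_of_odd_off_diag hcardB B ?_ ?_
    · rintro (i | i) <;> simp [B, hd]
    · rintro (i | i) (j | j) hij
      · exact absurd rfl hij
      · simp [B]
      · simp [B]
      · exact ho i j fun h => hij (h ▸ rfl)
  have hB0 : B.det ≠ 0 := by
    rintro h; rw [h] at hBodd; exact absurd hBodd (by decide)
  have hker : ∀ x : ι → ℤ, A *ᵥ x = 0 → ∀ i j, x i = x j := by
    intro x hx
    -- The multiple `n x - (∑ x) 1` of the projection of `x` is killed by the bordered matrix.
    have h0 := Matrix.eq_zero_of_mulVec_eq_zero hB0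
      (v := Sum.elim (fun _ => 0) (fun i => n * x i - ∑ j, x j)) (by
        funext i
        rcases i with i | i
        · simp [B, mulVec, dotProduct, Fintype.sum_sum_type, ← Finset.mul_sum, hn]
        · have hxi : ∑ j, A i j * x j = 0 := congrFun hx i
          simp only [B, mulVec, dotProduct, Fintype.sum_sum_type, fromBlocks_apply₂₁,
            fromBlocks_apply₂₂, Sum.elim_inl, Sum.elim_inr, mul_zero, Finset.sum_const_zero,
            zero_add, mul_sub, Finset.sum_sub_distrib, ← Finset.sum_mul, h1, zero_mul, sub_zero,
            Pi.zero_apply]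
          simp only [mul_left_comm _ n, ← Finset.mul_sum, hxi, mul_zero])
    intro i j
    have hi := congrFun h0 (Sum.inr i)
    have hj := congrFun h0 (Sum.inr j)
    simp only [Sum.elim_inr, Pi.zero_apply] at hi hj
    exact mul_left_cancel₀ hn0 (by linarith)
  have hdet : A.det = 0 := by
    rw [← Matrix.exists_mulVec_eq_zero_iff]
    refine ⟨1, one_ne_zero, ?_⟩
    funext i
    simpa [mulVec, dotProduct] using h1 i
  have hcol : ∀ i i' j, A.adjugate i j = A.adjugate i' j := by
    intro i i' j
    refine hker (fun k => A.adjugate k j) ?_ i i'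
    have h := Matrix.mul_adjugate A
    rw [hdet, zero_smul] at h
    funext k
    exact congrFun (congrFun h k) j
  have hrow : ∀ i j j', A.adjugate i j = A.adjugate i j' := by
    intro i j j'
    refine hker (fun k => A.adjugate i k) ?_ j j'
    have h := Matrix.adjugate_mul A
    rw [hdet, zero_smul] at h
    funext k
    have hk : ∑ l, A.adjugate i l * A l k = 0 := congrFun (congrFun h i) k
    simp only [mulVec, dotProduct, Pi.zero_apply]
    rw [← neg_eq_zero, ← hk, ← Finset.sum_neg_distrib]
    exact Finset.sum_congr rfl fun l _ => by rw [hsk k l]; ring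
  obtain ⟨i₀⟩ := this
  set γ := A.adjugate i₀ i₀ with hγ
  have hall : ∀ i j, A.adjugate i j = γ := fun i j => by rw [hcol i i₀ j, hrow i₀ j i₀]
  have hBdet : B.det = γ * n ^ 2 := by
    let e : Unit ⊕ ι → ℤ := Sum.elim 1 0
    have hBe : B + vecMulVec e e =
        fromBlocks 1 (Matrix.of fun _ _ => -1) (Matrix.of fun _ _ => 1) A := by
      ext (i | i) (j | j) <;> simp [B, e, vecMulVec_apply]
    have h2 : A - (Matrix.of fun (_ : ι) (_ : Unit) => (1 : ℤ)) *
        (Matrix.of fun (_ : Unit) (_ : ι) => (-1 : ℤ)) = A + vecMulVec 1 1 := by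
      ext i j; simp [Matrix.mul_apply]
    have h3 := det_add_vecMulVec B e e
    rw [dotProduct_adjugate_mulVec_eq_zero hcardB B hB, add_zero, hBe, det_fromBlocks_one₁₁, h2,
      det_add_vecMulVec, hdet, zero_add] at h3
    rw [← h3]
    simp only [dotProduct, mulVec, hall, Pi.one_apply, mul_one, Finset.sum_const, Finset.card_univ,
      one_mul, nsmul_eq_mul]
    ring
  obtain ⟨s, hs⟩ := isSquare_det_int_of_transpose_eq_neg B hB
  have hdvd : n ∣ s := by
    rw [← Int.pow_dvd_pow_iff two_ne_zero]
    exact ⟨γ, by rw [sq s, ← hs, hBdet]; ring⟩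
  obtain ⟨c, hc⟩ := hdvd
  have hγc : γ = c ^ 2 := by
    refine mul_right_cancel₀ (pow_ne_zero 2 hn0) ?_
    rw [← hBdet, hs, hc]; ring
  have hγodd : Odd γ := by rw [hBdet] at hBodd; exact (Int.odd_mul.mp hBodd).1
  have hcodd : Odd c := by rw [hγc, Int.odd_pow' two_ne_zero] at hγodd; exact hγodd
  have hc0 : c ≠ 0 := by rintro rfl; exact absurd hcodd (by decide)
  exact ⟨|c|, abs_pos.mpr hc0, odd_abs.mpr hcodd, fun i j => by rw [hall, hγc, sq_abs]⟩

/-! ### Symmetric matrices commuting with a permutation -/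

/-- The skew-symmetric matrix `T - T⁻¹ + 1 vᵀ - v 1ᵀ`, where `T` is the operator `x ↦ x ∘ σ` of
the permutation `σ`. -/
def skewIntertwiner {ι : Type*} [DecidableEq ι] (σ : Equiv.Perm ι) (v : ι → ℤ) : Matrix ι ι ℤ :=
  Matrix.of fun i j => (if σ i = j then 1 else 0) - (if σ j = i then 1 else 0) + v j - v i

theorem skewIntertwiner_transpose {ι : Type*} [DecidableEq ι] (σ : Equiv.Perm ι) (v : ι → ℤ) :
    (skewIntertwiner σ v)ᵀ = -skewIntertwiner σ v := by
  ext i j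
  simp only [skewIntertwiner, transpose_apply, of_apply, neg_apply]
  ring

theorem skewIntertwiner_mulVec {ι : Type*} [Fintype ι] [DecidableEq ι] (σ : Equiv.Perm ι)
    (v x : ι → ℤ) (i : ι) :
    (skewIntertwiner σ v *ᵥ x) i =
      x (σ i) - x (σ.symm i) + ∑ j, v j * x j - v i * ∑ j, x j := by
  have h : ∀ j, (if σ j = i then (1 : ℤ) else 0) = if j = σ.symm i then 1 else 0 := fun j => by
    simp only [Equiv.eq_symm_apply]
  simp only [skewIntertwiner, mulVec, dotProduct, of_apply, sub_mul, add_mul,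
    Finset.sum_sub_distrib, Finset.sum_add_distrib, h, ite_mul, one_mul, zero_mul,
    Finset.sum_ite_eq, Finset.sum_ite_eq', Finset.mem_univ, if_true, Finset.mul_sum]

theorem eq_of_iterate_eq {ι α : Type*} {σ : Equiv.Perm ι} {x : ι → α}
    (hx : ∀ i, x (σ (σ i)) = x i) (k : ℕ) (i : ι) : x (((σ ^ 2) ^ k) i) = x i := by
  induction k with
  | zero => rfl
  | succ k ih => rw [pow_succ', ← ih]; exact hx _

theorem sum_eq_zero_of_perm_neg {ι : Type*} [Fintype ι] {σ : Equiv.Perm ι} {v : ι → ℤ}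
    (hv : ∀ i, v (σ i) = -v i) : ∑ i, v i = 0 := by
  have h := Equiv.sum_comp σ v
  simp only [hv, Finset.sum_neg_distrib] at h
  omega

/-- A vector in the kernel is orthogonal to `1` and `v`, and fixed by `T²`; so it is constant on
the two level sets of `v`, and vanishes. -/
theorem skewIntertwiner_det_ne_zero {ι : Type*} [Fintype ι] [DecidableEq ι] [Nonempty ι]
    (σ : Equiv.Perm ι) (v : ι → ℤ) (hv : ∀ i, v i = 1 ∨ v i = -1) (hvσ : ∀ i, v (σ i) = -v i)
    (horb : ∀ i j, v i = v j → ∃ k : ℕ, ((σ ^ 2) ^ k) i = j) :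
    (skewIntertwiner σ v).det ≠ 0 := by
  intro h0
  obtain ⟨x, hx0, hx⟩ := Matrix.exists_mulVec_eq_zero_iff.mpr h0
  have hx' : ∀ i, x (σ i) - x (σ.symm i) + ∑ j, v j * x j - v i * ∑ j, x j = 0 := fun i => by
    rw [← skewIntertwiner_mulVec, hx]; rfl
  have hn : (Fintype.card ι : ℤ) ≠ 0 := by exact_mod_cast Fintype.card_ne_zero
  have hvs : ∀ i, v (σ.symm i) = -v i := fun i => by
    have := hvσ (σ.symm i); rw [Equiv.apply_symm_apply] at this; omega
  have hvv : ∀ i, v i * v i = 1 := fun i => by rcases hv i with h | h <;> rw [h] <;> norm_num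
  have hvx : ∑ j, v j * x j = 0 := by
    have h := Finset.sum_congr (rfl : Finset.univ = Finset.univ) fun i (_ : i ∈ Finset.univ) => hx' i
    simp only [Finset.sum_sub_distrib, Finset.sum_add_distrib, Equiv.sum_comp, Finset.sum_const,
      ← Finset.sum_mul, sum_eq_zero_of_perm_neg hvσ, Finset.card_univ, nsmul_eq_mul, mul_zero,
      zero_mul, sub_zero, sub_self, zero_add] at h
    exact (mul_eq_zero.mp h).resolve_left hn
  have hxs : ∑ j, x j = 0 := by
    have h := Finset.sum_congr (rfl : Finset.univ = Finset.univ)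
      fun i (_ : i ∈ Finset.univ) => congrArg (v i * ·) (hx' i)
    have e1 : ∑ i, v i * x (σ i) = 0 := by
      have h := Equiv.sum_comp σ fun i => v i * x i
      simp only [hvσ, neg_mul, Finset.sum_neg_distrib, hvx] at h
      exact neg_eq_zero.mp h
    have e2 : ∑ i, v i * x (σ.symm i) = 0 := by
      have h := Equiv.sum_comp σ.symm fun i => v i * x i
      simp only [hvs, neg_mul, Finset.sum_neg_distrib, hvx] at h
      exact neg_eq_zero.mp h
    simp only [hvx, mul_sub, ← mul_assoc, hvv, Finset.sum_sub_distrib,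
      e1, e2, mul_zero, one_mul, Finset.sum_const_zero, Finset.sum_const,
      Finset.card_univ, nsmul_eq_mul, sub_zero, add_zero, zero_sub, neg_eq_zero] at h
    exact (mul_eq_zero.mp h).resolve_left hn
  have hx2 : ∀ i, x (σ (σ i)) = x i := fun i => by
    have := hx' (σ i)
    rw [hvx, hxs, Equiv.symm_apply_apply] at this
    linarith
  have hcst : ∀ i j, v i = v j → x i = x j := fun i j hij => by
    obtain ⟨k, rfl⟩ := horb i j hij
    exact (eq_of_iterate_eq hx2 k i).symm
  refine hx0 (funext fun i => ?_)
  have hs : ∑ j, (1 + v i * v j) * x i = 0 := by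
    calc ∑ j, (1 + v i * v j) * x i = ∑ j, (x j + v i * (v j * x j)) := by
          refine Finset.sum_congr rfl fun j _ => ?_
          by_cases h : v i = v j
          · rw [hcst i j h, h]; ring
          · have hi := hv i
            have hj := hv j
            have hij : v j = -v i := by omega
            rw [hij]
            linear_combination (x i - x j) * -hvv i
      _ = 0 := by rw [Finset.sum_add_distrib, ← Finset.mul_sum, hvx, hxs]; ring
  rw [← Finset.sum_mul, Finset.sum_add_distrib, ← Finset.mul_sum,
    sum_eq_zero_of_perm_neg hvσ] at hs
  simp only [Finset.sum_const, Finset.card_univ, nsmul_eq_mul, mul_one, mul_zero, add_zero] at hs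
  exact (mul_eq_zero.mp hs).resolve_left hn

/-- Let `A` be symmetric of even size, invariant under `σ`, with row sums `-1`, and `v` a sign
vector negated by `σ` whose level sets are the orbits of `σ²`. Then `v` is an eigenvector, and
a rank-one change makes `A` act by the same scalar on `1` and on `v`. The changed matrix commutes
with the skew-symmetric `skewIntertwiner σ v`, so their product is again skew-symmetric; the two
skew-symmetric determinants being squares, so is that of the changed matrix. -/
theorem Matrix.exists_dotProduct_adjugate_eq_neg_sq {ι : Type*} [Fintype ι] [DecidableEq ι]
    [Nonempty ι] (hι : Even (Fintype.card ι)) (A : Matrix ι ι ℤ) (hA : ∀ i j, A j i = A i j)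
    (hd : ∀ i, A i i = 0) (ho : ∀ i j, i ≠ j → Odd (A i j)) (h1 : ∀ i, ∑ j, A i j = -1)
    (σ : Equiv.Perm ι) (hσ : ∀ i j, A (σ i) (σ j) = A i j)
    (v : ι → ℤ) (hv : ∀ i, v i = 1 ∨ v i = -1) (hvσ : ∀ i, v (σ i) = -v i)
    (horb : ∀ i j, v i = v j → ∃ k : ℕ, ((σ ^ 2) ^ k) i = j) :
    ∃ c : ℤ, 0 < c ∧ Odd c ∧ v ⬝ᵥ (A.adjugate *ᵥ v) = -((Fintype.card ι : ℤ) * c ^ 2) := by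
  set n : ℤ := (Fintype.card ι : ℤ) with hn
  have hn0 : n ≠ 0 := by rw [hn]; exact_mod_cast Fintype.card_ne_zero
  have hvv : ∀ i, v i * v i = 1 := fun i => by rcases hv i with h | h <;> rw [h] <;> norm_num
  have hvs : ∀ i, v (σ.symm i) = -v i := fun i => by
    have := hvσ (σ.symm i); rw [Equiv.apply_symm_apply] at this; omega
  have hsumv : ∑ i, v i = 0 := sum_eq_zero_of_perm_neg hvσ
  have hsumvv : ∑ i, v i * v i = n := by simp [hvv, hn]
  have hdodd : Odd A.det := odd_det_of_odd_off_diag hι A hd ho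
  -- `A v` changes sign under `σ`, which makes it a multiple of `v`.
  have hy : ∀ i, (A *ᵥ v) (σ i) = -(A *ᵥ v) i := fun i => by
    simp only [mulVec, dotProduct]
    rw [← Equiv.sum_comp σ]
    simp [hσ, hvσ]
  obtain ⟨i₀⟩ := ‹Nonempty ι›
  obtain ⟨a, hav⟩ : ∃ a : ℤ, A *ᵥ v = a • v := by
    have hy2 : ∀ i, (A *ᵥ v) (σ (σ i)) = (A *ᵥ v) i := fun i => by rw [hy, hy, neg_neg]
    have hcst : ∀ i j, v i = v j → (A *ᵥ v) i = (A *ᵥ v) j := fun i j hij => by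
      obtain ⟨k, rfl⟩ := horb i j hij
      exact (eq_of_iterate_eq hy2 k i).symm
    refine ⟨v i₀ * (A *ᵥ v) i₀, funext fun i => ?_⟩
    rw [Pi.smul_apply, smul_eq_mul]
    by_cases h : v i = v i₀
    · rw [hcst i i₀ h, h]
      linear_combination (-(A *ᵥ v) i₀) * hvv i₀
    · have h' : v (σ i) = v i₀ := by
        have hi := hv i
        have hj := hv i₀
        rw [hvσ]; omega
      have h2 := hcst _ _ h'
      rw [hy] at h2
      rw [hvσ] at h'
      rw [← h', ← h2]
      linear_combination (-(A *ᵥ v) i) * hvv i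
  -- Hence `v` is an eigenvector of the adjugate, with an odd eigenvalue `μ`.
  set μ : ℤ := v i₀ * (A.adjugate *ᵥ v) i₀ with hμ
  have hadj : ∀ i, a * (A.adjugate *ᵥ v) i = A.det * v i := fun i => by
    have h := congrFun (congrArg (· *ᵥ v) (adjugate_mul A)) i
    simp only [← mulVec_mulVec, hav, mulVec_smul, smul_mulVec, one_mulVec, Pi.smul_apply,
      smul_eq_mul] at h
    exact h
  have haμ : a * μ = A.det := by
    rw [hμ]; linear_combination (v i₀) * hadj i₀ + A.det * hvv i₀
  have ha0 : a ≠ 0 := by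
    rintro rfl; rw [zero_mul] at haμ; rw [← haμ] at hdodd; exact absurd hdodd (by decide)
  have hadjv : A.adjugate *ᵥ v = μ • v := funext fun i =>
    mul_left_cancel₀ ha0 (by rw [hadj, ← haμ, Pi.smul_apply, smul_eq_mul]; ring)
  have hq : v ⬝ᵥ (A.adjugate *ᵥ v) = n * μ := by
    rw [hadjv, dotProduct_smul, smul_eq_mul, dotProduct, hsumvv, mul_comm]
  have hμodd : Odd μ := by rw [← haμ] at hdodd; exact (Int.odd_mul.mp hdodd).2
  -- `C` is `n A` changed along `v` so as to act by `-n` on both `1` and `v`.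
  let C : Matrix ι ι ℤ := n • A + vecMulVec ((-1 - a) • v) v
  have hCdet : C.det = -μ * n ^ Fintype.card ι := by
    obtain ⟨m, hm⟩ : ∃ m, Fintype.card ι = m + 1 :=
      ⟨Fintype.card ι - 1, by have := Fintype.card_pos_iff.mpr ⟨i₀⟩; omega⟩
    rw [det_add_vecMulVec, det_smul, adjugate_smul, mulVec_smul, smul_mulVec, hadjv, ← haμ,
      dotProduct_smul, dotProduct_smul, dotProduct_smul, dotProduct, hsumvv, hm]
    simp only [smul_eq_mul, Nat.add_sub_cancel]
    ring
  have hCapp : ∀ i j, C i j = n * A i j + (-1 - a) * (v i * v j) := fun i j => by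
    simp only [C, add_apply, smul_apply, smul_eq_mul, vecMulVec_apply, Pi.smul_apply]; ring
  have hCsymm : ∀ i j, C j i = C i j := fun i j => by rw [hCapp, hCapp, hA i j]; ring
  have hCσ : ∀ i j, C (σ i) (σ j) = C i j := fun i j => by
    rw [hCapp, hCapp, hσ, hvσ, hvσ]; ring
  have hC1 : ∀ i, ∑ j, C i j = -n := fun i => by
    simp only [hCapp, Finset.sum_add_distrib, ← Finset.mul_sum, h1, hsumv]; ring
  have hCv : ∀ i, ∑ j, C i j * v j = -n * v i := fun i => by
    have hi : ∑ j, A i j * v j = a * v i := congrFun hav i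
    have : ∑ j, C i j * v j = n * ∑ j, A i j * v j + (-1 - a) * v i * ∑ j, v j * v j := by
      rw [Finset.mul_sum, Finset.mul_sum, ← Finset.sum_add_distrib]
      exact Finset.sum_congr rfl fun j _ => by rw [hCapp]; ring
    rw [this, hi, hsumvv]; ring
  let K := skewIntertwiner σ v
  have hK : Kᵀ = -K := skewIntertwiner_transpose σ v
  have hKC : ∀ i j, (K * C) i j = C (σ i) j - C (σ.symm i) j - n * v j + n * v i := fun i j => by
    have h : (K * C) i j = (K *ᵥ fun k => C k j) i := rfl
    have e1 : ∑ k, v k * C k j = -n * v j := by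
      rw [← hCv]; exact Finset.sum_congr rfl fun k _ => by rw [hCsymm j k, mul_comm]
    have e2 : ∑ k, C k j = -n := by
      rw [← hC1 j]; exact Finset.sum_congr rfl fun k _ => hCsymm j k
    rw [h, skewIntertwiner_mulVec, e1, e2]; ring
  have hskew : (K * C)ᵀ = -(K * C) := by
    ext i j
    rw [transpose_apply, neg_apply, hKC, hKC]
    have e1 : C (σ.symm j) i = C (σ i) j := by
      rw [← hCσ, Equiv.apply_symm_apply, hCsymm]
    have e2 : C (σ j) i = C (σ.symm i) j := by
      rw [← hCσ (σ.symm i), Equiv.apply_symm_apply, hCsymm]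
    rw [e1, e2]; ring
  obtain ⟨s, hs⟩ := isSquare_det_int_of_transpose_eq_neg K hK
  obtain ⟨t, ht⟩ := isSquare_det_int_of_transpose_eq_neg (K * C) hskew
  obtain ⟨m, hm⟩ := hι
  have hs0 : s ≠ 0 := by
    rintro rfl
    have : Nonempty ι := ⟨i₀⟩
    exact skewIntertwiner_det_ne_zero σ v hv hvσ horb hs
  have hsn : s * n ^ m ≠ 0 := mul_ne_zero hs0 (pow_ne_zero m hn0)
  have htt : (s * n ^ m) ^ 2 * (-μ) = t ^ 2 := by
    rw [sq t, ← ht, det_mul, hCdet, hs, hm]; ring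
  obtain ⟨c, hc⟩ : s * n ^ m ∣ t := by
    rw [← Int.pow_dvd_pow_iff two_ne_zero]; exact ⟨-μ, htt.symm⟩
  have hμc : -μ = c ^ 2 := by
    refine mul_left_cancel₀ (pow_ne_zero 2 hsn) ?_
    rw [htt, hc]; ring
  have hcodd : Odd c := by
    rw [← Int.odd_pow' (n := 2) two_ne_zero, ← hμc]; exact hμodd.neg
  have hc0 : c ≠ 0 := by rintro rfl; exact absurd hcodd (by decide)
  refine ⟨|c|, abs_pos.mpr hc0, odd_abs.mpr hcodd, ?_⟩
  rw [hq, sq_abs, ← hμc]; ring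

/-! ### Sums over the half system `1, …, (p - 1) / 2` -/

theorem sum_zmod_eq_sum_range {M : Type*} [AddCommMonoid M] (p : ℕ) [NeZero p] (f : ZMod p → M) :
    ∑ x, f x = ∑ i ∈ Finset.range p, f i := by
  refine Finset.sum_bij' (fun x _ => x.val) (fun i _ => (i : ZMod p)) ?_ ?_ ?_ ?_ ?_
  · intro x _; exact Finset.mem_range.mpr (ZMod.val_lt x)
  · intro i _; exact Finset.mem_univ _
  · intro x _; exact ZMod.natCast_zmod_val x
  · intro i hi; exact ZMod.val_natCast_of_lt (Finset.mem_range.mp hi)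
  · intro x _; rw [ZMod.natCast_zmod_val]

theorem two_mul_sub_one_div_two_add_one {p : ℕ} [Fact p.Prime] (hp : p ≠ 2) :
    2 * ((p - 1) / 2) + 1 = p := by
  have := (Fact.out : p.Prime).eq_two_or_odd
  omega

theorem sum_even_eq_add_two_mul {p : ℕ} [Fact p.Prime] (hp : p ≠ 2) (f : ZMod p → ℤ)
    (hf : ∀ x, f (-x) = f x) :
    ∑ x, f x = f 0 + 2 * ∑ j : ↥(Finset.Icc 1 ((p - 1) / 2)), f ((j : ℕ) : ZMod p) := by
  have hn := two_mul_sub_one_div_two_add_one hp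
  rw [sum_zmod_eq_sum_range, Finset.sum_coe_sort (Finset.Icc 1 ((p - 1) / 2))
    (fun j : ℕ => f (j : ZMod p))]
  set n := (p - 1) / 2
  have e0 : ∑ j ∈ Finset.Icc 1 n, f (j : ZMod p) =
      ∑ i ∈ Finset.range n, f ((i + 1 : ℕ) : ZMod p) := by
    rw [← Finset.Ico_add_one_right_eq_Icc, Finset.sum_Ico_eq_sum_range]
    exact Finset.sum_congr rfl fun i _ => by rw [add_comm 1 i]
  have e1 : ∑ i ∈ Finset.range p, f (i : ZMod p) =
      ∑ i ∈ Finset.range (n + n + 1), f (i : ZMod p) := by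
    congr 2; omega
  rw [e1, Finset.sum_range_succ', Finset.sum_range_add, e0, two_mul, Nat.cast_zero, add_comm]
  congr 2
  rw [← Finset.sum_range_reflect]
  refine Finset.sum_congr rfl fun i hi => ?_
  rw [Finset.mem_range] at hi
  rw [← hf]
  congr 1
  have h : ((n + (n - 1 - i) + 1 : ℕ) : ZMod p) + ((i + 1 : ℕ) : ZMod p) = 0 := by
    rw [← Nat.cast_add, show n + (n - 1 - i) + 1 + (i + 1) = p by omega, ZMod.natCast_self]
  linear_combination -h

/-- Factoring `a² - x²` and substituting `x = a (1 - 2 y)` turns this sum into a Jacobi sum. -/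
theorem sum_quadraticChar_sq_sub_sq {p : ℕ} [Fact p.Prime] (hp : p ≠ 2) {a : ZMod p} (ha : a ≠ 0) :
    ∑ x : ZMod p, quadraticChar (ZMod p) (a ^ 2 - x ^ 2) = -quadraticChar (ZMod p) (-1) := by
  have hc : ringChar (ZMod p) ≠ 2 := by rwa [ZMod.ringChar_zmod_n]
  have h2 : (2 : ZMod p) ≠ 0 := Ring.two_ne_zero hc
  have hJ := jacobiSum_nontrivial_inv (quadraticChar_ne_one hc)
  rw [(quadraticChar_isQuadratic (ZMod p)).inv] at hJ
  rw [← hJ, jacobiSum]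
  have hinj : Function.Injective fun y : ZMod p => a - 2 * a * y := by
    intro y z h
    have h' : 2 * a * (y - z) = 0 := by linear_combination -h
    exact sub_eq_zero.mp ((mul_eq_zero.mp h').resolve_left (mul_ne_zero h2 ha))
  rw [← (Finite.injective_iff_bijective.mp hinj).sum_comp]
  refine Finset.sum_congr rfl fun y _ => ?_
  rw [show a ^ 2 - (a - 2 * a * y) ^ 2 = (2 * a) ^ 2 * (y * (1 - y)) by ring, map_mul,
    quadraticChar_sq_one' (mul_ne_zero h2 ha), one_mul, map_mul]

section HalfSystem

variable {p : ℕ} [Fact p.Prime]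

theorem natCast_ne_zero_of_half (j : ↥(Finset.Icc 1 ((p - 1) / 2))) : ((j : ℕ) : ZMod p) ≠ 0 := by
  have hj := Finset.mem_Icc.mp j.2
  rw [Ne, ZMod.natCast_eq_zero_iff]
  exact fun h => absurd (Nat.le_of_dvd (by omega) h) (by omega)

theorem eq_of_natCast_sq_eq {j k : ↥(Finset.Icc 1 ((p - 1) / 2))}
    (h : ((j : ℕ) : ZMod p) ^ 2 = ((k : ℕ) : ZMod p) ^ 2) : j = k := by
  have hj := Finset.mem_Icc.mp j.2
  have hk := Finset.mem_Icc.mp k.2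
  rcases sq_eq_sq_iff_eq_or_eq_neg.mp h with h | h
  · rw [ZMod.natCast_eq_natCast_iff'] at h
    rw [Nat.mod_eq_of_lt (by omega), Nat.mod_eq_of_lt (by omega)] at h
    exact Subtype.ext h
  · rw [eq_neg_iff_add_eq_zero, ← Nat.cast_add, ZMod.natCast_eq_zero_iff] at h
    exact absurd (Nat.le_of_dvd (by omega) h) (by omega)

theorem exists_half_sq_eq (hp : p ≠ 2) {x : ZMod p} (hx : x ≠ 0) :
    ∃ j : ↥(Finset.Icc 1 ((p - 1) / 2)), ((j : ℕ) : ZMod p) ^ 2 = x ^ 2 := by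
  have hn := two_mul_sub_one_div_two_add_one hp
  have h1 := ZMod.natAbs_valMinAbs_le x
  have h2 : x.valMinAbs.natAbs ≠ 0 := by simpa using hx
  refine ⟨⟨x.valMinAbs.natAbs, Finset.mem_Icc.mpr ⟨by omega, by omega⟩⟩, ?_⟩
  have h3 : ((x.valMinAbs.natAbs : ℤ) ^ 2) = x.valMinAbs ^ 2 := Int.natAbs_sq _
  have h4 := congrArg (Int.cast : ℤ → ZMod p) h3
  rw [Int.cast_pow, Int.cast_pow, Int.cast_natCast, ZMod.coe_valMinAbs] at h4
  exact h4

/-- Multiplication by `g` on the representatives `1, …, (p - 1) / 2` of `(ℤ/p)ˣ / {±1}`. -/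
theorem exists_perm_half_sq (hp : p ≠ 2) {g : ZMod p} (hg : g ≠ 0) :
    ∃ σ : Equiv.Perm ↥(Finset.Icc 1 ((p - 1) / 2)),
      ∀ j, ((σ j : ℕ) : ZMod p) ^ 2 = g ^ 2 * ((j : ℕ) : ZMod p) ^ 2 := by
  choose f hf using fun j : ↥(Finset.Icc 1 ((p - 1) / 2)) =>
    exists_half_sq_eq hp (mul_ne_zero hg (natCast_ne_zero_of_half j))
  have hinj : Function.Injective f := fun j k h => by
    have h1 := hf j
    rw [h, hf k, mul_pow, mul_pow] at h1
    exact (eq_of_natCast_sq_eq (mul_left_cancel₀ (pow_ne_zero 2 hg) h1)).symm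
  refine ⟨Equiv.ofBijective f (Finite.injective_iff_bijective.mp hinj), fun j => ?_⟩
  rw [Equiv.ofBijective_apply, hf, mul_pow]

end HalfSystem

/-! ### The matrix of Legendre symbols -/

/-- The integer matrix `((j² - k²)/p)`. -/
def legendreMatrix (p : ℕ) [Fact p.Prime] (δ : ℕ) :
    Matrix ↥(Finset.Icc δ ((p - 1) / 2)) ↥(Finset.Icc δ ((p - 1) / 2)) ℤ :=
  Matrix.of fun j k => legendreSym p ((j : ℤ) ^ 2 - (k : ℤ) ^ 2)

/-- The vector `(j/p)`. -/
def legendreVec (p : ℕ) [Fact p.Prime] (δ : ℕ) : ↥(Finset.Icc δ ((p - 1) / 2)) → ℤ :=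
  fun j => legendreSym p (j : ℤ)

section LegendreMatrix

variable {p : ℕ} [Fact p.Prime]

theorem legendreMatrix_apply (δ : ℕ) (j k : ↥(Finset.Icc δ ((p - 1) / 2))) :
    legendreMatrix p δ j k =
      quadraticChar (ZMod p) (((j : ℕ) : ZMod p) ^ 2 - ((k : ℕ) : ZMod p) ^ 2) := by
  simp [legendreMatrix, legendreSym]

theorem legendreVec_apply (δ : ℕ) (j : ↥(Finset.Icc δ ((p - 1) / 2))) :
    legendreVec p δ j = quadraticChar (ZMod p) ((j : ℕ) : ZMod p) := by
  simp [legendreVec, legendreSym]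

theorem legendreD_eq (δ : ℕ) {R : Type*} [CommRing R] (w : R) :
    legendreD p δ w =
      w * ((legendreVec p δ ⬝ᵥ ((legendreMatrix p δ).adjugate *ᵥ legendreVec p δ) : ℤ) : R) := by
  let f := Int.castRingHom R
  let v : ↥(Finset.Icc δ ((p - 1) / 2)) → R := fun j => f (legendreVec p δ j)
  have h1 : legendreDetZero p δ R = (f.mapMatrix (legendreMatrix p δ)).det := rfl
  have h2 : legendreDet p δ w =
      (f.mapMatrix (legendreMatrix p δ) + vecMulVec (w • v) v).det := by
    unfold legendreDet
    congr 1
    ext j k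
    simp only [of_apply, Matrix.add_apply, RingHom.mapMatrix_apply, map_apply, legendreMatrix,
      vecMulVec_apply, Pi.smul_apply, smul_eq_mul, v, f, legendreVec, eq_intCast,
      legendreSym.mul, Int.cast_mul]
    ring
  rw [legendreD, h1, h2, det_add_vecMulVec, add_sub_cancel_left, mulVec_smul, dotProduct_smul,
    smul_eq_mul, ← RingHom.map_adjugate]
  congr 1
  simp [v, f, dotProduct, mulVec, Finset.mul_sum]

theorem quadraticChar_neg_one_of_one_mod_four (h : p % 4 = 1) :
    quadraticChar (ZMod p) (-1) = 1 := by
  have h2 := legendreSym.at_neg_one (p := p) (by rintro rfl; omega)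
  rw [ZMod.χ₄_nat_one_mod_four h] at h2
  simpa [legendreSym] using h2

theorem quadraticChar_neg_one_of_three_mod_four (h : p % 4 = 3) :
    quadraticChar (ZMod p) (-1) = -1 := by
  have h2 := legendreSym.at_neg_one (p := p) (by rintro rfl; omega)
  rw [ZMod.χ₄_nat_three_mod_four h] at h2
  simpa [legendreSym] using h2

theorem legendreMatrix_self (δ : ℕ) (j : ↥(Finset.Icc δ ((p - 1) / 2))) :
    legendreMatrix p δ j j = 0 := by
  rw [legendreMatrix_apply, sub_self, quadraticChar_zero]

theorem legendreMatrix_swap (δ : ℕ) (j k : ↥(Finset.Icc δ ((p - 1) / 2))) :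
    legendreMatrix p δ k j = quadraticChar (ZMod p) (-1) * legendreMatrix p δ j k := by
  rw [legendreMatrix_apply, legendreMatrix_apply, ← map_mul, neg_one_mul, neg_sub]

theorem odd_legendreMatrix {j k : ↥(Finset.Icc 1 ((p - 1) / 2))} (h : j ≠ k) :
    Odd (legendreMatrix p 1 j k) := by
  rw [legendreMatrix_apply]
  rcases quadraticChar_dichotomy (sub_ne_zero.mpr fun h' => h (eq_of_natCast_sq_eq h')) with h | h
  · rw [h]; exact odd_one
  · rw [h]; exact odd_neg_one

theorem two_mul_sum_legendreMatrix (hp : p ≠ 2) (j : ↥(Finset.Icc 1 ((p - 1) / 2))) :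
    2 * ∑ k, legendreMatrix p 1 j k = -1 - quadraticChar (ZMod p) (-1) := by
  have hj := natCast_ne_zero_of_half j
  have h := sum_even_eq_add_two_mul hp
    (fun x => quadraticChar (ZMod p) (((j : ℕ) : ZMod p) ^ 2 - x ^ 2)) (fun x => by rw [neg_sq])
  rw [sum_quadraticChar_sq_sub_sq hp hj] at h
  simp only [ne_eq, OfNat.ofNat_ne_zero, not_false_eq_true, zero_pow, sub_zero,
    quadraticChar_sq_one' hj] at h
  simp only [legendreMatrix_apply]
  linarith

theorem sum_legendreVec_eq_zero (h : p % 4 = 1) : ∑ j, legendreVec p 1 j = 0 := by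
  have hp : p ≠ 2 := by rintro rfl; omega
  have hc : ringChar (ZMod p) ≠ 2 := by rwa [ZMod.ringChar_zmod_n]
  have hs := sum_even_eq_add_two_mul hp (fun x => quadraticChar (ZMod p) x) (fun x => by
    rw [← neg_one_mul, map_mul, quadraticChar_neg_one_of_one_mod_four h, one_mul])
  rw [quadraticChar_sum_zero hc, quadraticChar_zero] at hs
  simp only [legendreVec_apply]
  linarith

/-- The indices `0, …, (p - 1) / 2` as `0` together with the indices `1, …, (p - 1) / 2`. -/
noncomputable def unitSumHalfEquiv (n : ℕ) :
    Unit ⊕ ↥(Finset.Icc 1 n) ≃ ↥(Finset.Icc 0 n) :=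
  Equiv.ofBijective
    (Sum.elim (fun _ => ⟨0, Finset.mem_Icc.mpr ⟨le_rfl, Nat.zero_le n⟩⟩)
      fun j => ⟨j, Finset.mem_Icc.mpr ⟨Nat.zero_le _, (Finset.mem_Icc.mp j.2).2⟩⟩) <| by
    constructor
    · refine Function.Injective.sumElim (fun _ _ _ => rfl) ?_ ?_
      · intro a b h
        exact Subtype.ext (congrArg (fun z : ↥(Finset.Icc 0 n) => (z : ℕ)) h)
      · intro _ b h
        have h1 := (Finset.mem_Icc.mp b.2).1
        have h2 : 0 = (b : ℕ) := congrArg Subtype.val h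
        omega
    · rintro ⟨k, hk⟩
      rcases Nat.eq_zero_or_pos k with rfl | h
      · exact ⟨Sum.inl (), rfl⟩
      · exact ⟨Sum.inr ⟨k, Finset.mem_Icc.mpr ⟨h, (Finset.mem_Icc.mp hk).2⟩⟩, rfl⟩

theorem unitSumHalfEquiv_inl (n : ℕ) (u : Unit) :
    (unitSumHalfEquiv n (Sum.inl u) : ℕ) = 0 := rfl

theorem unitSumHalfEquiv_inr (n : ℕ) (j : ↥(Finset.Icc 1 n)) :
    (unitSumHalfEquiv n (Sum.inr j) : ℕ) = j := rfl

/-- Adding all other columns to the column of index `0` leaves only its top entry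
`(p - 1) / 2`, because the rows of the inner block sum to `-1`. -/
theorem legendreDet_zero_eq (h : p % 4 = 1) (w : ℤ) :
    legendreDet p 0 w = (((p - 1) / 2 : ℕ) : ℤ) * legendreDet p 1 w := by
  have hp : p ≠ 2 := by rintro rfl; omega
  let A : Matrix ↥(Finset.Icc 1 ((p - 1) / 2)) ↥(Finset.Icc 1 ((p - 1) / 2)) ℤ :=
    Matrix.of fun j k => legendreMatrix p 1 j k + legendreVec p 1 j * legendreVec p 1 k * w
  have h1 : legendreDet p 1 w = A.det := by
    unfold legendreDet
    congr 1
    ext j k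
    simp [A, legendreMatrix, legendreVec, legendreSym.mul]
  have h0 : legendreDet p 0 w =
      (fromBlocks (0 : Matrix Unit Unit ℤ) (Matrix.of fun _ _ => 1) (Matrix.of fun _ _ => 1) A).det := by
    unfold legendreDet
    rw [← Matrix.det_submatrix_equiv_self (unitSumHalfEquiv ((p - 1) / 2))]
    congr 1
    have hj (j : ↥(Finset.Icc 1 ((p - 1) / 2))) :
        quadraticChar (ZMod p) (((j : ℕ) : ZMod p) ^ 2) = 1 :=
      quadraticChar_sq_one' (natCast_ne_zero_of_half j)
    have hj' (j : ↥(Finset.Icc 1 ((p - 1) / 2))) :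
        quadraticChar (ZMod p) (-(((j : ℕ) : ZMod p) ^ 2)) = 1 := by
      rw [← neg_one_mul, map_mul, quadraticChar_neg_one_of_one_mod_four h, hj, one_mul]
    ext (j | j) (k | k)
    · simp [unitSumHalfEquiv_inl]
    · simpa [unitSumHalfEquiv_inl, unitSumHalfEquiv_inr, legendreSym] using hj' k
    · simpa [unitSumHalfEquiv_inl, unitSumHalfEquiv_inr, legendreSym] using hj j
    · simp [unitSumHalfEquiv_inr, A, legendreMatrix, legendreVec, legendreSym.mul]
  have hA : ∀ j, ∑ k, A j k = -1 := fun j => by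
    have hs := two_mul_sum_legendreMatrix hp j
    rw [quadraticChar_neg_one_of_one_mod_four h] at hs
    have e : ∑ k, A j k =
        ∑ k, legendreMatrix p 1 j k + legendreVec p 1 j * w * ∑ k, legendreVec p 1 k := by
      rw [Finset.mul_sum, ← Finset.sum_add_distrib]
      exact Finset.sum_congr rfl fun k _ => by simp only [A, of_apply]; ring
    rw [e, sum_legendreVec_eq_zero h]
    linarith
  let L : Matrix (Unit ⊕ ↥(Finset.Icc 1 ((p - 1) / 2))) (Unit ⊕ ↥(Finset.Icc 1 ((p - 1) / 2))) ℤ :=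
    fromBlocks 1 0 (Matrix.of fun _ _ => 1) 1
  have hL : L.det = 1 := by simp [L]
  have hmul : fromBlocks (0 : Matrix Unit Unit ℤ) (Matrix.of fun _ _ => 1)
      (Matrix.of fun _ _ => 1) A * L =
      fromBlocks (Matrix.of fun _ _ => (((p - 1) / 2 : ℕ) : ℤ)) (Matrix.of fun _ _ => 1) 0 A := by
    rw [fromBlocks_multiply]
    congr 1
    · ext i j
      simp [Matrix.mul_apply]
    · simp
    · ext i j
      have hi := hA i
      rw [Finset.univ_eq_attach] at hi
      simp [Matrix.mul_apply, hi]
    · simp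
  have hdet := congrArg det hmul
  rw [det_mul, hL, mul_one] at hdet
  rw [h0, h1, hdet, det_fromBlocks_zero₂₁, det_unique]
  rfl

end LegendreMatrix

section OneModFour

variable {p : ℕ} [Fact p.Prime]

/-- A generator `g` of `(ℤ/p)ˣ` permutes `(ℤ/p)ˣ / {±1}`. As `(-1/p) = 1`, the Legendre symbol
is defined on this quotient, is negated by `g`, and its fibres are the orbits of `g²`. -/
theorem exists_perm_half_orbits (h : p % 4 = 1) :
    ∃ σ : Equiv.Perm ↥(Finset.Icc 1 ((p - 1) / 2)),
      (∀ j k, legendreMatrix p 1 (σ j) (σ k) = legendreMatrix p 1 j k) ∧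
      (∀ j, legendreVec p 1 (σ j) = -legendreVec p 1 j) ∧
      ∀ j k, legendreVec p 1 j = legendreVec p 1 k → ∃ m : ℕ, ((σ ^ 2) ^ m) j = k := by
  have hp : p ≠ 2 := by rintro rfl; omega
  have hc : ringChar (ZMod p) ≠ 2 := by rwa [ZMod.ringChar_zmod_n]
  obtain ⟨g, hg⟩ := IsCyclic.exists_generator (α := (ZMod p)ˣ)
  have hg0 : (g : ZMod p) ≠ 0 := g.ne_zero
  have hpow : ∀ x : ZMod p, x ≠ 0 → ∃ m : ℕ, (g : ZMod p) ^ m = x := fun x hx => by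
    obtain ⟨m, hm⟩ := mem_powers_iff_mem_zpowers.mpr (hg (Units.mk0 x hx))
    exact ⟨m, by simpa using congrArg Units.val hm⟩
  have hχg : quadraticChar (ZMod p) (g : ZMod p) = -1 := by
    refine (quadraticChar_dichotomy hg0).resolve_left fun h1 => ?_
    obtain ⟨x, hx⟩ := quadraticChar_exists_neg_one hc
    have hx0 : x ≠ 0 := by rintro rfl; simp at hx
    obtain ⟨m, rfl⟩ := hpow x hx0
    rw [map_pow, h1, one_pow] at hx
    exact absurd hx (by decide)
  obtain ⟨σ, hσ⟩ := exists_perm_half_sq hp hg0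
  refine ⟨σ, fun j k => ?_, fun j => ?_, fun j k hjk => ?_⟩
  · rw [legendreMatrix_apply, legendreMatrix_apply, hσ, hσ, ← mul_sub, map_mul,
      quadraticChar_sq_one' hg0, one_mul]
  · rw [legendreVec_apply, legendreVec_apply]
    have hs := hσ j
    rw [← mul_pow, sq_eq_sq_iff_eq_or_eq_neg] at hs
    rcases hs with hs | hs
    · rw [hs, map_mul, hχg, neg_one_mul]
    · rw [hs, ← neg_one_mul, map_mul, map_mul, hχg, quadraticChar_neg_one_of_one_mod_four h,
        one_mul, neg_one_mul]
  · have hj := natCast_ne_zero_of_half j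
    obtain ⟨m, hm⟩ := hpow (((k : ℕ) : ZMod p) / ((j : ℕ) : ZMod p))
      (div_ne_zero (natCast_ne_zero_of_half k) hj)
    rw [eq_div_iff hj] at hm
    have heven : Even m := by
      rw [legendreVec_apply, legendreVec_apply, ← hm, map_mul, map_pow, hχg] at hjk
      have h1 : (-1 : ℤ) ^ m = 1 := by
        refine mul_right_cancel₀ (b := quadraticChar (ZMod p) ((j : ℕ) : ZMod p)) ?_
          (by rw [one_mul, ← hjk])
        rwa [Ne, quadraticChar_eq_zero_iff]
      exact (neg_one_pow_eq_one_iff_even (by decide)).mp h1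
    have hit : ∀ t : ℕ, (((σ ^ t) j : ℕ) : ZMod p) ^ 2 = (g : ZMod p) ^ (2 * t) * (j : ℕ) ^ 2 := by
      intro t
      induction t with
      | zero => simp
      | succ t ih =>
        have e : (σ ^ (t + 1)) j = σ ((σ ^ t) j) := by rw [pow_succ', Equiv.Perm.mul_apply]
        rw [e, hσ, ih]; ring
    obtain ⟨l, rfl⟩ := heven
    refine ⟨l, eq_of_natCast_sq_eq ?_⟩
    rw [← pow_mul, hit, ← hm]
    ring

end OneModFour

/-! ### The evaluation of the two determinants -/

/-- `w` ranges over an arbitrary commutative ring (in particular it may be a number or the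
indeterminate of a polynomial ring), and `c` depends on `p` alone. -/
theorem theorem1p1 (p : ℕ) [Fact p.Prime] (hp : p ≠ 2) :
    (p % 4 = 1 →
      ∃ c : ℤ, 0 < c ∧ Odd c ∧
        ∀ (R : Type u) [CommRing R] (w : R),
          legendreD p 0 w = (((p - 1) / 2 : ℕ) : R) * legendreD p 1 w ∧
          (((p - 1) / 2 : ℕ) : R) * legendreD p 1 w =
            -w * ((((p - 1) / 2 : ℕ) : R) * (c : R)) ^ 2) ∧
    (p % 4 = 3 →
      (∀ (R : Type u) [CommRing R] (w : R), legendreD p 0 w = 0) ∧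
      ∃ c : ℤ, 0 < c ∧ Odd c ∧
        ∀ (R : Type u) [CommRing R] (w : R),
          legendreD p 1 w =
            w * ((c : R) *
              ∑ k ∈ Finset.Icc 1 ((p - 1) / 2), ((legendreSym p (k : ℤ) : ℤ) : R)) ^ 2) := by
  have hp2 := (Fact.out : p.Prime).two_le
  constructor
  · intro h
    obtain ⟨σ, hσ, hvσ, horb⟩ := exists_perm_half_orbits h
    have : Nonempty ↥(Finset.Icc 1 ((p - 1) / 2)) :=
      ⟨⟨1, Finset.mem_Icc.mpr ⟨le_rfl, by omega⟩⟩⟩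
    obtain ⟨c, hc0, hcodd, hc⟩ := exists_dotProduct_adjugate_eq_neg_sq
      (by rw [Fintype.card_coe, Nat.card_Icc, Nat.even_iff]; omega) (legendreMatrix p 1)
      (fun i j => by rw [legendreMatrix_swap, quadraticChar_neg_one_of_one_mod_four h, one_mul])
      (legendreMatrix_self 1) (fun i j hij => odd_legendreMatrix hij)
      (fun i => by
        have := two_mul_sum_legendreMatrix hp i
        rw [quadraticChar_neg_one_of_one_mod_four h] at this
        linarith)
      σ hσ (legendreVec p 1)
      (fun i => by
        rw [legendreVec_apply]; exact quadraticChar_dichotomy (natCast_ne_zero_of_half i))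
      hvσ horb
    rw [Fintype.card_coe, Nat.card_Icc, Nat.add_sub_cancel] at hc
    -- The relation between the two determinants over `ℤ` at `w = 1` and `w = 0` gives the
    -- relation between the coefficients of `w`.
    have h01 : legendreD p 0 (1 : ℤ) = (((p - 1) / 2 : ℕ) : ℤ) * legendreD p 1 (1 : ℤ) := by
      have hz : ∀ δ, legendreDetZero p δ ℤ = legendreDet p δ (0 : ℤ) := fun δ => by
        simp only [legendreDet, legendreDetZero, mul_zero, add_zero]
      rw [legendreD, legendreD, hz, hz, legendreDet_zero_eq h, legendreDet_zero_eq h]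
      ring
    rw [legendreD_eq, legendreD_eq, one_mul, one_mul, Int.cast_id, Int.cast_id, hc] at h01
    refine ⟨c, hc0, hcodd, fun R _ w => ?_⟩
    rw [legendreD_eq, legendreD_eq, h01, hc]
    simp only [Int.cast_mul, Int.cast_neg, Int.cast_pow, Int.cast_natCast]
    constructor <;> ring
  · intro h
    have hskew : ∀ δ, (legendreMatrix p δ)ᵀ = -legendreMatrix p δ := fun δ => by
      ext i j
      rw [transpose_apply, legendreMatrix_swap, quadraticChar_neg_one_of_three_mod_four h,
        neg_one_mul, Matrix.neg_apply]
    refine ⟨fun R _ w => ?_, ?_⟩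
    · rw [legendreD_eq, dotProduct_adjugate_mulVec_eq_zero _ _ (hskew 0), Int.cast_zero, mul_zero]
      rw [Fintype.card_coe, Nat.card_Icc, Nat.even_iff]; omega
    · obtain ⟨c, hc0, hcodd, hc⟩ := exists_adjugate_eq_sq_of_transpose_eq_neg
        (by rw [Fintype.card_coe, Nat.card_Icc, Nat.odd_iff]; omega) (legendreMatrix p 1) (hskew 1)
        (fun i j hij => odd_legendreMatrix hij)
        (fun i => by
          have := two_mul_sum_legendreMatrix hp i
          rw [quadraticChar_neg_one_of_three_mod_four h] at this
          linarith)
      refine ⟨c, hc0, hcodd, fun R _ w => ?_⟩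
      have hs : legendreVec p 1 ⬝ᵥ ((legendreMatrix p 1).adjugate *ᵥ legendreVec p 1) =
          (c * ∑ k ∈ Finset.Icc 1 ((p - 1) / 2), legendreSym p (k : ℤ)) ^ 2 := by
        rw [← Finset.sum_coe_sort (Finset.Icc 1 ((p - 1) / 2)) fun k : ℕ => legendreSym p (k : ℤ)]
        simp only [dotProduct, mulVec, hc, ← Finset.mul_sum, ← Finset.sum_mul]
        change (∑ k, legendreVec p 1 k) * _ = (c * ∑ k, legendreVec p 1 k) ^ 2
        ring
      rw [legendreD_eq, hs]
      push_cast
      rfl
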